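/- Let $Q=[0,1]^{\mathbb N}$ be the Hilbert cube with the metric $d_Q(x,y)=\sum_i 2^{-i}|x_i-y_i|$. The rational balls are the open $d_Q$-balls of positive rational radius centered at points with rational coordinates, finitely many of them non-zero; they are numbered in the standard way. Let $\mathcal K(Q)$ be the set of compact subsets of $Q$. A pair $(X,A)$ consists of a compact metrizable space $X$ and a compact subset $A\subseteq X$. A copy of $(X,A)$ in $Q$ is a pair $(Y,B)$ with $Y\subseteq Q$ such that some homeomorphism from $X$ onto $Y$ maps $A$ onto $B$. For an oracle $O\subseteq\mathbb N$, a compact set $K\subseteq Q$ is semicomputable relative to $O$ if the set of finite lists of rational balls whose union contains $K$ is c.e. relative to $O$; it is computable relative to $O$ if moreover the set of rational balls that intersect $K$ is c.e. relative to $O$. The pair $(X,A)$ has strong computable type if for every oracle $O$ and every copy $(Y,B)$ of $(X,A)$ in $Q$, if $Y$ and $B$ are semicomputable relative to $O$, then $Y$ is computable relative to $O$. The upper Vietoris topology on $\mathcal K(Q)$ is generated by the sets $\{K: K\subseteq U\}$ with $U\subseteq Q$ open; a numbered basis is obtained by letting $U$ range over the finite unions of rational balls, and $\mathcal K(Q)\times\mathcal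 K(Q)$ carries the product topology $\tau$ with the basis of products of these basic sets. A property of pairs is a subset $\mathcal P\subseteq\mathcal K(Q)\times\mathcal K(Q)$; it is $\Pi^0_1$ in $\tau$ if its complement is the union of a c.e. family of basic open sets. A pair $(Y,B)$ in $Q$ is $\mathcal P$-minimal if $(Y,B)\in\mathcal P$ and $(Y',B')\notin\mathcal P$ for every pair $(Y',B')$ with $Y'\subsetneq Y$ and $B'\subseteq B$. Theorem. For every pair $(X,A)$, the following statements are equivalent: 1. $(X,A)$ has strong computable type; 2. for every copy $(Y,B)$ of $(X,A)$ in $Q$ there exists a property of pairs $\mathcal P$ which is $\Pi^0_1$ in $\tau$ and such that $(Y,B)$ is $\mathcal P$-minimal. -/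

import Mathlib

open TopologicalSpace

noncomputable section

/-! ### Oracle computability -/

/-- A predicate on a coded type is c.e. relative to the oracle `O ⊆ ℕ` if it is the domain of a
partial function that is recursive in the characteristic function of `O`. -/
def REPredIn {ι : Type} [Primcodable ι] (O : Set ℕ) (p : ι → Prop) : Prop :=
  RecursiveIn {fun n : ℕ => Part.some (O.indicator (fun _ => 1) n)}
    (fun a : ι => Part.assert (p a) fun _ => Part.some ())

/-! ### Effective notions with respect to a numbered basis `B : ι → Set Z`

The index set is any coded type `ι` instead of `ℕ`. -/

/-- Effectively open (`Σ⁰₁`) sets: unions of a c.e. family of basic open sets. -/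
def EffectivelyOpen {Z ι : Type} [Primcodable ι] (B : ι → Set Z) (S : Set Z) : Prop :=
  ∃ E : Set ι, REPred (fun i => i ∈ E) ∧ S = ⋃ i ∈ E, B i

/-- Effectively closed (`Π⁰₁`) sets: complements of effectively open sets. -/
def EffectivelyClosed {Z ι : Type} [Primcodable ι] (B : ι → Set Z) (S : Set Z) : Prop :=
  EffectivelyOpen B Sᶜ

/-- `K` is semicomputable (effectively compact) relative to `O`: it is compact and its finite covers
by basic open sets are c.e. relative to `O`. -/
def SemicomputableIn {Z ι : Type} [TopologicalSpace Z] [Primcodable ι] (O : Set ℕ) (B : ι → Set Z)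
    (K : Set Z) : Prop :=
  IsCompact K ∧ REPredIn O (fun l : List ι => K ⊆ ⋃ i ∈ l, B i)

/-- `K` is computably overt relative to `O`: the basic open sets that meet `K` are c.e. relative
to `O`. -/
def OvertIn {Z ι : Type} [Primcodable ι] (O : Set ℕ) (B : ι → Set Z) (K : Set Z) : Prop :=
  REPredIn O (fun i : ι => (K ∩ B i).Nonempty)

/-- `K` is computable relative to `O`: effectively compact and computably overt relative to `O`. -/
def ComputableSetIn {Z ι : Type} [TopologicalSpace Z] [Primcodable ι] (O : Set ℕ) (B : ι → Set Z)
    (K : Set Z) : Prop :=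
  SemicomputableIn O B K ∧ OvertIn O B K

/-! ### The Hilbert cube -/

/-- The Hilbert cube `[0,1]^ℕ`, with the product topology (which is the topology of `distQ`, see
`isTopologicalBasis_ratBall`). -/
abbrev HilbertCube : Type := ℕ → unitInterval

/-- The metric `d(x, y) = ∑ᵢ 2⁻ⁱ |xᵢ - yᵢ|` of the Hilbert cube. -/
def distQ (x y : HilbertCube) : ℝ := ∑' i : ℕ, (1 / 2 : ℝ) ^ i * |(x i : ℝ) - (y i : ℝ)|

/-- The point of the Hilbert cube with rational coordinates `min (a / (b + 1)) 1`, where `(a, b)`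
is the `i`-th entry of the list, and `0` beyond the end of the list. -/
def ratPoint (l : List (ℕ × ℕ)) : HilbertCube := fun i =>
  Set.projIcc (0 : ℝ) 1 zero_le_one (((l.getD i (0, 0)).1 : ℝ) / ((l.getD i (0, 0)).2 + 1))

/-- Indices of rational balls: a code for the center, and a code `(m, n)` for the radius
`(m + 1) / (n + 1)`. -/
abbrev BallIndex : Type := List (ℕ × ℕ) × ℕ × ℕ

/-- The numbered basis of rational balls: open `distQ`-balls of positive rational radius centered at
points with rational coordinates, finitely many of them non-zero. -/
def ratBall (b : BallIndex) : Set HilbertCube :=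
  {x | distQ (ratPoint b.1) x < ((b.2.1 : ℝ) + 1) / ((b.2.2 : ℝ) + 1)}

/-! ### The hyperspace of compact sets, pairs and copies -/

/-- The upper Vietoris topology on the hyperspace of compact subsets. -/
def upperVietoris (Z : Type) [TopologicalSpace Z] : TopologicalSpace (Compacts Z) :=
  TopologicalSpace.generateFrom {W | ∃ U : Set Z, IsOpen U ∧ W = {K : Compacts Z | (K : Set Z) ⊆ U}}

/-- The numbered basis of the upper Vietoris topology on `𝒦(Q)`: sets `{K | K ⊆ U}` where `U` is a
finite union of rational balls. -/
def upBasis (l : List BallIndex) : Set (Compacts HilbertCube) :=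
  {K | (K : Set HilbertCube) ⊆ ⋃ b ∈ l, ratBall b}

/-- The numbered basis of the product topology on `𝒦(Q) × 𝒦(Q)`, each factor carrying the upper
Vietoris topology (see `isTopologicalBasis_upBasis₂`). -/
def upBasis₂ (p : List BallIndex × List BallIndex) :
    Set (Compacts HilbertCube × Compacts HilbertCube) :=
  upBasis p.1 ×ˢ upBasis p.2

/-- `(Y, B) ∈ 𝒦(Q) × 𝒦(Q)` is a pair. -/
def IsPair (p : Compacts HilbertCube × Compacts HilbertCube) : Prop :=
  (p.2 : Set HilbertCube) ⊆ p.1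

/-- `(Y, B)` is a copy of the pair `(X, A)` in the Hilbert cube: some homeomorphism from `X` to `Y`
sends `A` onto `B`. -/
def IsCopy {X : Type*} [TopologicalSpace X] (A : Set X)
    (p : Compacts HilbertCube × Compacts HilbertCube) : Prop :=
  ∃ h : X ≃ₜ (p.1 : Set HilbertCube), (fun x => (h x : HilbertCube)) '' A = p.2

/-- The pair `q` is a proper subpair of the pair `p` (the second components may be equal). -/
def IsProperSubpair (q p : Compacts HilbertCube × Compacts HilbertCube) : Prop :=
  IsPair q ∧ IsPair p ∧
    (q.1 : Set HilbertCube) ⊂ p.1 ∧ (q.2 : Set HilbertCube) ⊆ p.2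

/-- `𝒫`-minimality of a pair in the Hilbert cube. -/
def IsMinimalFor (P : Set (Compacts HilbertCube × Compacts HilbertCube))
    (p : Compacts HilbertCube × Compacts HilbertCube) : Prop :=
  IsPair p ∧ p ∈ P ∧ ∀ q, IsProperSubpair q p → q ∉ P

/-- The pair `(X, A)` has strong computable type: for every oracle `O` and every copy `(Y, B)` in
the Hilbert cube, if `Y` and `B` are semicomputable relative to `O` then `Y` is computable relative
to `O`. -/
def HasStrongComputableType {X : Type*} [TopologicalSpace X] (A : Set X) : Prop :=
  ∀ (O : Set ℕ) (p : Compacts HilbertCube × Compacts HilbertCube), IsCopy A p →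
    SemicomputableIn O ratBall (p.1 : Set HilbertCube) →
    SemicomputableIn O ratBall (p.2 : Set HilbertCube) →
    ComputableSetIn O ratBall (p.1 : Set HilbertCube)

/-! ### The numbered families above are bases of the intended topologies -/

theorem summable_distQ (x y : HilbertCube) :
    Summable fun i : ℕ => (1 / 2 : ℝ) ^ i * |(x i : ℝ) - (y i : ℝ)| := by
  refine Summable.of_nonneg_of_le (fun i => by positivity) (fun i => ?_)
    (summable_geometric_of_lt_one (r := (1 / 2 : ℝ)) (by norm_num) (by norm_num))
  have h : |(x i : ℝ) - (y i : ℝ)| ≤ 1 := by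
    rw [abs_le]
    constructor <;> linarith [(x i).2.1, (x i).2.2, (y i).2.1, (y i).2.2]
  exact mul_le_of_le_one_right (by positivity) h

theorem continuous_distQ : Continuous fun q : HilbertCube × HilbertCube => distQ q.1 q.2 := by
  refine continuous_tsum (u := fun i : ℕ => (1 / 2 : ℝ) ^ i) (fun i => by fun_prop)
    (summable_geometric_of_lt_one (by norm_num) (by norm_num)) (fun i q => ?_)
  have h : |(q.1 i : ℝ) - (q.2 i : ℝ)| ≤ 1 := by
    rw [abs_le]
    constructor <;> linarith [(q.1 i).2.1, (q.1 i).2.2, (q.2 i).2.1, (q.2 i).2.2]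
  rw [Real.norm_of_nonneg (by positivity)]
  exact mul_le_of_le_one_right (by positivity) h

theorem distQ_self (x : HilbertCube) : distQ x x = 0 := by simp [distQ]

theorem distQ_comm (x y : HilbertCube) : distQ x y = distQ y x := by
  simp only [distQ, abs_sub_comm]

theorem distQ_triangle (x y z : HilbertCube) : distQ x z ≤ distQ x y + distQ y z := by
  unfold distQ
  rw [← (summable_distQ x y).tsum_add (summable_distQ y z)]
  refine (summable_distQ x z).tsum_le_tsum (fun i => ?_)
    ((summable_distQ x y).add (summable_distQ y z))
  rw [← mul_add]
  exact mul_le_mul_of_nonneg_left (abs_sub_le _ _ _) (by positivity)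

theorem distQ_pos {x y : HilbertCube} (h : x ≠ y) : 0 < distQ x y := by
  obtain ⟨i, hi⟩ := Function.ne_iff.mp h
  refine (summable_distQ x y).tsum_pos (fun j => by positivity) i ?_
  have : (x i : ℝ) - (y i : ℝ) ≠ 0 := sub_ne_zero.mpr fun h => hi (Subtype.ext h)
  positivity

theorem exists_ratPoint_mem {U : Set HilbertCube} (hU : IsOpen U) {x : HilbertCube} (hx : x ∈ U) :
    ∃ l, ratPoint l ∈ U := by
  obtain ⟨I, u, hu, hsub⟩ := isOpen_pi_iff.mp hU x hx
  have key : ∀ i, ∃ p : ℕ × ℕ, i ∈ I →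
      Set.projIcc (0 : ℝ) 1 zero_le_one ((p.1 : ℝ) / (p.2 + 1)) ∈ u i := by
    intro i
    by_cases hi : i ∈ I
    · have hc : Continuous fun t : ℝ => Set.projIcc (0 : ℝ) 1 zero_le_one |t| :=
        continuous_projIcc.comp continuous_abs
      have ho := (hu i hi).1.preimage hc
      obtain ⟨q, hq⟩ := Rat.denseRange_cast.exists_mem_open ho ⟨(x i : ℝ), by
        have h0 : |(x i : ℝ)| = x i := abs_of_nonneg (x i).2.1
        simp only [Set.mem_preimage, h0, Set.projIcc_val]
        exact (hu i hi).2⟩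
      refine ⟨(q.num.natAbs, q.den - 1), fun _ => ?_⟩
      have h1 : ((q.den - 1 : ℕ) : ℝ) + 1 = q.den := by
        have := q.pos
        exact_mod_cast Nat.sub_add_cancel this
      have h2 : (q.num.natAbs : ℝ) / q.den = |(q : ℝ)| := by
        rw [Rat.cast_def, abs_div, Nat.abs_cast, Nat.cast_natAbs, Int.cast_abs]
      simp only [h1, h2]
      exact hq
    · exact ⟨(0, 0), fun h => absurd h hi⟩
  choose f hf using key
  refine ⟨(List.range (I.sup id + 1)).map f, hsub fun i hi => ?_⟩
  have hlt : i < I.sup id + 1 := Nat.lt_succ_of_le (Finset.le_sup (f := id) hi)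
  have hget : ((List.range (I.sup id + 1)).map f).getD i (0, 0) = f i := by
    simp [List.getD, hlt]
  simp only [ratPoint, hget]
  exact hf i hi

theorem isOpen_ratBall (b : BallIndex) : IsOpen (ratBall b) :=
  isOpen_lt (continuous_distQ.comp (by fun_prop : Continuous fun x => (ratPoint b.1, x)))
    continuous_const

theorem isTopologicalBasis_ratBall : IsTopologicalBasis (Set.range ratBall) := by
  refine isTopologicalBasis_of_isOpen_of_nhds ?_ fun x U hx hU => ?_
  · rintro _ ⟨b, rfl⟩
    exact isOpen_ratBall b
  · obtain ⟨ε, hε, hεU⟩ : ∃ ε > 0, ∀ y, distQ x y < ε → y ∈ U := by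
      rcases Uᶜ.eq_empty_or_nonempty with he | hne
      · exact ⟨1, one_pos, fun y _ => by rw [Set.compl_empty_iff.mp he]; trivial⟩
      · have hc : Continuous fun y => distQ x y :=
          continuous_distQ.comp (by fun_prop : Continuous fun y => (x, y))
        obtain ⟨z, hz, hmin⟩ := hU.isClosed_compl.isCompact.exists_isMinOn hne hc.continuousOn
        refine ⟨distQ x z, distQ_pos fun h => hz (h ▸ hx), fun y hy => ?_⟩
        by_contra hyU
        exact absurd (hmin hyU) (not_le.mpr hy)
    obtain ⟨n, hn⟩ := exists_nat_one_div_lt (half_pos hε)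
    have hc : Continuous fun y => distQ y x :=
      continuous_distQ.comp (by fun_prop : Continuous fun y => (y, x))
    obtain ⟨l, hl⟩ := exists_ratPoint_mem
      (isOpen_lt hc (continuous_const (y := 1 / ((n : ℝ) + 1))))
      (x := x) (by
        have : (0 : ℝ) < 1 / ((n : ℝ) + 1) := by positivity
        simpa [distQ_self] using this)
    have hl' : distQ (ratPoint l) x < 1 / ((n : ℝ) + 1) := hl
    refine ⟨_, ⟨(l, 0, n), rfl⟩, by simpa [ratBall] using hl', fun y hy => hεU y ?_⟩
    have hy' : distQ (ratPoint l) y < 1 / ((n : ℝ) + 1) := by simpa [ratBall] using hy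
    have := distQ_triangle x (ratPoint l) y
    rw [distQ_comm x (ratPoint l)] at this
    linarith

theorem isTopologicalBasis_upBasis :
    @IsTopologicalBasis _ (upperVietoris HilbertCube) (Set.range upBasis) := by
  let _ := upperVietoris HilbertCube
  refine isTopologicalBasis_of_isOpen_of_nhds ?_ fun K W hK hW => ?_
  · rintro _ ⟨l, rfl⟩
    exact isOpen_generateFrom_of_mem
      ⟨⋃ b ∈ l, ratBall b, isOpen_iUnion fun b => isOpen_iUnion fun _ => isOpen_ratBall b, rfl⟩
  · obtain ⟨U, hU, hKU, hUW⟩ : ∃ U : Set HilbertCube, IsOpen U ∧ (K : Set HilbertCube) ⊆ U ∧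
        {L : Compacts HilbertCube | (L : Set HilbertCube) ⊆ U} ⊆ W := by
      have hW' : GenerateOpen {W | ∃ U : Set HilbertCube, IsOpen U ∧
        W = {K : Compacts HilbertCube | (K : Set HilbertCube) ⊆ U}} W := hW
      clear hW
      induction hW' with
      | basic s hs =>
        obtain ⟨U, hU, rfl⟩ := hs
        exact ⟨U, hU, hK, subset_rfl⟩
      | univ => exact ⟨Set.univ, isOpen_univ, Set.subset_univ _, Set.subset_univ _⟩
      | inter s t _ _ hs ht =>
        obtain ⟨U, hU, hKU, hUs⟩ := hs hK.1
        obtain ⟨V, hV, hKV, hVt⟩ := ht hK.2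
        exact ⟨U ∩ V, hU.inter hV, Set.subset_inter hKU hKV, fun L hL =>
          ⟨hUs (hL.trans Set.inter_subset_left), hVt (hL.trans Set.inter_subset_right)⟩⟩
      | sUnion S _ ih =>
        obtain ⟨s, hs, hKs⟩ := hK
        obtain ⟨U, hU, hKU, hUs⟩ := ih s hs hKs
        exact ⟨U, hU, hKU, hUs.trans (Set.subset_sUnion_of_mem hs)⟩
    obtain ⟨t, ht⟩ := K.isCompact.elim_finite_subcover
      (fun b : {b : BallIndex // ratBall b ⊆ U} => ratBall b) (fun b => isOpen_ratBall b)
      (fun x hx => by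
        obtain ⟨_, ⟨b, rfl⟩, hxb, hbU⟩ :=
          isTopologicalBasis_ratBall.exists_subset_of_mem_open (hKU hx) hU
        exact Set.mem_iUnion.mpr ⟨⟨b, hbU⟩, hxb⟩)
    refine ⟨_, ⟨t.toList.map Subtype.val, rfl⟩, fun x hx => ?_, fun L hL => hUW fun x hx => ?_⟩
    · obtain ⟨b, hb, hxb⟩ := Set.mem_iUnion₂.mp (ht hx)
      exact Set.mem_iUnion₂.mpr ⟨b, List.mem_map.mpr ⟨b, Finset.mem_toList.mpr hb, rfl⟩, hxb⟩
    · obtain ⟨b, hb, hxb⟩ := Set.mem_iUnion₂.mp (hL hx)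
      obtain ⟨c, _, rfl⟩ := List.mem_map.mp hb
      exact c.2 hxb

theorem isTopologicalBasis_upBasis₂ :
    @IsTopologicalBasis _
      (@instTopologicalSpaceProd _ _ (upperVietoris HilbertCube) (upperVietoris HilbertCube))
      (Set.range upBasis₂) := by
  let _ := upperVietoris HilbertCube
  convert isTopologicalBasis_upBasis.prod isTopologicalBasis_upBasis
  ext W
  simp only [Set.mem_range, Set.mem_image2, Prod.exists, upBasis₂, exists_exists_eq_and]

end

/-! The equivalence holds copy by copy, and all that is used of a copy `(Y, B)` is `B ⊆ Y`.

Minimality yields computability (`IsMinimalFor.overtIn`). Removing a rational ball from `Y` and `B`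
gives a proper subpair exactly when the ball meets `Y`. By minimality this happens exactly when the
remaining pair lies in the effectively open complement of the property. A finite cover witnesses the
latter, so an oracle that enumerates the covers of `Y` and `B` enumerates the balls meeting `Y`.

Conversely, suppose that every oracle enumerating the finite covers of `Y` and `B` enumerates the
balls meeting `Y`. Selman's theorem (`exists_rePred_of_forall_oracle`) makes this uniform: there is
one c.e. relation `W i F` such that ball `i` meets `Y` iff `W i F` for some finite list `F` of true
covers. The property says, roughly, that a pair never satisfies all covers in `F` while its first
component misses ball `i`, for `W i F`. The pair `(Y, B)` has it. A proper subpair inherits the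
covers but misses a small ball meeting `Y`, so it fails. Inclusion and disjointness of balls are
replaced by decidable inequalities between centers and radii, so that the complement is a c.e. union
of basic open sets; by compactness, small balls satisfy these inequalities
(`exists_effectivelyClosed_isMinimalFor`).

Selman's theorem is proved by forcing with finite sequences. This needs relative enumerability as a
primitive recursive relation on initial segments of the oracle (`REPredIn.exists_primrecRel`,
`REPredIn.of_primrecRel`). -/

/-! ### Finite approximations of oracle computations -/

/-- The list of the first `k` values of `g`. -/
def initSeg (g : ℕ → ℕ) (k : ℕ) : List ℕ := (List.range k).map g

@[simp] theorem length_initSeg (g : ℕ → ℕ) (k : ℕ) : (initSeg g k).length = k := by simp [initSeg]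

theorem initSeg_succ (g : ℕ → ℕ) (k : ℕ) : initSeg g (k + 1) = initSeg g k ++ [g k] := by
  simp [initSeg, List.range_succ]

theorem initSeg_prefix (g : ℕ → ℕ) {k m : ℕ} (h : k ≤ m) : initSeg g k <+: initSeg g m := by
  induction h with
  | refl => exact List.prefix_rfl
  | step _ ih => exact ih.trans (by rw [initSeg_succ]; exact List.prefix_append _ _)

theorem initSeg_getElem? (g : ℕ → ℕ) {k n : ℕ} (h : n < k) : (initSeg g k)[n]? = some (g n) := by
  simp [initSeg, h]

/-- `F` computes the partial function `f` from finite initial segments of the oracle `g`; the length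
of the segment also bounds the search. -/
structure IsApprox (g : ℕ → ℕ) (f : ℕ → Part ℕ) (F : ℕ → List ℕ → Option ℕ) : Prop where
  primrec : Primrec₂ F
  mono : ∀ {n σ τ y}, σ <+: τ → F n σ = some y → F n τ = some y
  mem_iff : ∀ n y, y ∈ f n ↔ ∃ k, F n (initSeg g k) = some y

namespace IsApprox

variable {g : ℕ → ℕ} {f h : ℕ → Part ℕ} {F H : ℕ → List ℕ → Option ℕ}

theorem mono_initSeg (hF : IsApprox g f F) {n k m y : ℕ} (hkm : k ≤ m)
    (hy : F n (initSeg g k) = some y) : F n (initSeg g m) = some y :=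
  hF.mono (initSeg_prefix g hkm) hy

theorem of_primrec {u : ℕ → ℕ} (hu : Primrec u) : IsApprox g (fun n => Part.some (u n))
    (fun n _ => some (u n)) where
  primrec := Primrec.option_some.comp (hu.comp Primrec.fst)
  mono _ h := h
  mem_iff n y := by simp [eq_comm]

theorem oracle : IsApprox g (fun n => Part.some (g n)) (fun n σ => σ[n]?) where
  primrec := Primrec.list_getElem?.comp Primrec.snd Primrec.fst
  mono hp h := by
    obtain ⟨t, rfl⟩ := hp
    obtain ⟨hn, rfl⟩ := List.getElem?_eq_some_iff.mp h
    rw [List.getElem?_append_left hn, h]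
  mem_iff n y := by
    constructor
    · intro hy
      exact ⟨n + 1, by simpa [initSeg, eq_comm] using hy⟩
    · rintro ⟨k, hk⟩
      obtain ⟨hn, rfl⟩ := List.getElem?_eq_some_iff.mp hk
      simp [initSeg]

theorem pair (hF : IsApprox g f F) (hH : IsApprox g h H) :
    IsApprox g (fun n => Nat.pair <$> f n <*> h n)
      (fun n σ => (F n σ).bind fun a => (H n σ).map fun b => Nat.pair a b) where
  primrec := by
    refine Primrec.option_bind hF.primrec (Primrec.option_map
      (hH.primrec.comp (Primrec.fst.comp Primrec.fst) (Primrec.snd.comp Primrec.fst)) ?_)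
    exact Primrec₂.natPair.comp (Primrec.snd.comp Primrec.fst) Primrec.snd
  mono {n σ τ y} hp hy := by
    simp only [Option.bind_eq_some_iff, Option.map_eq_some_iff] at hy ⊢
    obtain ⟨a, ha, b, hb, rfl⟩ := hy
    exact ⟨a, hF.mono hp ha, b, hH.mono hp hb, rfl⟩
  mem_iff n y := by
    simp only [Option.bind_eq_some_iff, Option.map_eq_some_iff, Part.map_eq_map, seq_eq_bind_map,
      Part.bind_eq_bind, Part.mem_bind_iff, Part.mem_map_iff, hF.mem_iff, hH.mem_iff]
    constructor
    · rintro ⟨_, ⟨a, ⟨k, hk⟩, rfl⟩, b, ⟨m, hm⟩, rfl⟩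
      exact ⟨max k m, a, hF.mono_initSeg (le_max_left _ _) hk, b,
        hH.mono_initSeg (le_max_right _ _) hm, rfl⟩
    · rintro ⟨k, a, ha, b, hb, rfl⟩
      exact ⟨_, ⟨a, ⟨k, ha⟩, rfl⟩, b, ⟨k, hb⟩, rfl⟩

theorem comp (hF : IsApprox g f F) (hH : IsApprox g h H) :
    IsApprox g (fun n => h n >>= f) (fun n σ => (H n σ).bind fun a => F a σ) where
  primrec := Primrec.option_bind hH.primrec
    (hF.primrec.comp Primrec.snd (Primrec.snd.comp Primrec.fst))
  mono hp hy := by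
    simp only [Option.bind_eq_some_iff] at hy ⊢
    obtain ⟨a, ha, hb⟩ := hy
    exact ⟨a, hH.mono hp ha, hF.mono hp hb⟩
  mem_iff n y := by
    simp only [Option.bind_eq_some_iff, Part.bind_eq_bind, Part.mem_bind_iff, hF.mem_iff,
      hH.mem_iff]
    constructor
    · rintro ⟨a, ⟨k, hk⟩, m, hm⟩
      exact ⟨max k m, a, hH.mono_initSeg (le_max_left _ _) hk,
        hF.mono_initSeg (le_max_right _ _) hm⟩
    · rintro ⟨k, a, ha, hb⟩
      exact ⟨a, ⟨k, ha⟩, k, hb⟩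

/-- All stages of the recursion read the same segment; monotonicity moves the finitely many
successful stages to a common longer one. -/
theorem prec (hF : IsApprox g f F) (hH : IsApprox g h H) :
    IsApprox g
      (fun p =>
        let (a, n) := Nat.unpair p
        n.rec (f a) fun y IH => do
          let i ← IH
          h (Nat.pair a (Nat.pair y i)))
      (fun p σ => p.unpair.2.rec (F p.unpair.1 σ) fun y IH =>
        IH.bind fun i => H (Nat.pair p.unpair.1 (Nat.pair y i)) σ) where
  primrec := by
    refine Primrec.nat_rec' (f := fun q : ℕ × List ℕ => q.1.unpair.2)
      (g := fun q : ℕ × List ℕ => F q.1.unpair.1 q.2)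
      (h := fun (q : ℕ × List ℕ) (r : ℕ × Option ℕ) =>
        r.2.bind fun i => H (Nat.pair q.1.unpair.1 (Nat.pair r.1 i)) q.2) ?_ ?_ ?_
    · exact Primrec.snd.comp (Primrec.unpair.comp Primrec.fst)
    · exact hF.primrec.comp (Primrec.fst.comp (Primrec.unpair.comp Primrec.fst)) Primrec.snd
    · refine Primrec.option_bind (Primrec.snd.comp Primrec.snd) (hH.primrec.comp
        (Primrec₂.natPair.comp ?_ (Primrec₂.natPair.comp ?_ Primrec.snd)) ?_)
      · exact Primrec.fst.comp (Primrec.unpair.comp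
          (Primrec.fst.comp (Primrec.fst.comp Primrec.fst)))
      · exact Primrec.fst.comp (Primrec.snd.comp Primrec.fst)
      · exact Primrec.snd.comp (Primrec.fst.comp Primrec.fst)
  mono {p σ τ y} hp hy := by
    revert hy
    induction p.unpair.2 generalizing y with
    | zero => intro hy; exact hF.mono hp hy
    | succ m ih =>
      intro hy
      simp only [Option.bind_eq_some_iff] at hy ⊢
      obtain ⟨a, ha, hb⟩ := hy
      exact ⟨a, ih ha, hH.mono hp hb⟩
  mem_iff p y := by
    dsimp only
    have mono : ∀ m k l y, k ≤ l →
        (Nat.rec (F p.unpair.1 (initSeg g k)) (fun y IH =>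
          IH.bind fun i => H (Nat.pair p.unpair.1 (Nat.pair y i)) (initSeg g k)) m : Option ℕ)
          = some y →
        (Nat.rec (F p.unpair.1 (initSeg g l)) (fun y IH =>
          IH.bind fun i => H (Nat.pair p.unpair.1 (Nat.pair y i)) (initSeg g l)) m : Option ℕ)
          = some y := by
      intro m k l y hkl hy
      induction m generalizing y with
      | zero => exact hF.mono_initSeg hkl hy
      | succ m ih =>
        simp only [Option.bind_eq_some_iff] at hy ⊢
        obtain ⟨a, ha, hb⟩ := hy
        exact ⟨a, ih _ ha, hH.mono_initSeg hkl hb⟩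
    induction p.unpair.2 generalizing y with
    | zero => exact hF.mem_iff _ _
    | succ m ih =>
      simp only [Option.bind_eq_some_iff]
      constructor
      · intro hy
        obtain ⟨a, ha, hb⟩ := Part.mem_bind_iff.mp hy
        obtain ⟨k, hk⟩ := (ih a).mp ha
        obtain ⟨l, hl⟩ := (hH.mem_iff _ _).mp hb
        exact ⟨max k l, a, mono _ _ _ _ (le_max_left _ _) hk,
          hH.mono_initSeg (le_max_right _ _) hl⟩
      · rintro ⟨k, a, ha, hb⟩
        exact Part.mem_bind_iff.mpr ⟨a, (ih a).mpr ⟨k, ha⟩, (hH.mem_iff _ _).mpr ⟨k, hb⟩⟩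

/-- The bounded search for the first argument at which `u` is `some 0`, provided that `u` takes
positive values before it. -/
def boundedFind (u : ℕ → Option ℕ) (k : ℕ) : Option ℕ :=
  let m := (List.range k).findIdx fun j => !((u j).any fun v => v != 0)
  if u m = some 0 then some m else none

/-- This form makes monotonicity in `k` and `u` visible. The bound is not strict: `findIdx` returns
the length `k` if all entries are positive, and the value at `k` is then tested. -/
theorem boundedFind_eq_some {u : ℕ → Option ℕ} {k m : ℕ} :
    boundedFind u k = some m ↔
      m ≤ k ∧ u m = some 0 ∧ ∀ j < m, ∃ v, u j = some v ∧ v ≠ 0 := by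
  have key : ∀ j, (!((u j).any fun v => v != 0)) = false ↔ ∃ v, u j = some v ∧ v ≠ 0 := by
    intro j
    cases u j <;> simp
  unfold boundedFind
  constructor
  · intro h
    dsimp only at h
    split_ifs at h with h0
    have hm := Option.some.inj h
    rw [hm] at h0
    have hle : m ≤ k := by
      have := List.findIdx_le_length (xs := List.range k)
        (p := fun j => !((u j).any fun v => v != 0))
      rw [hm] at this
      simpa using this
    refine ⟨hle, h0, fun j hj => ?_⟩
    have hj' := List.not_of_lt_findIdx (hm ▸ hj :
      j < (List.range k).findIdx fun j => !((u j).any fun v => v != 0))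
    rw [List.getElem_range] at hj'
    exact (key j).mp (by simpa using hj')
  · rintro ⟨hmk, h0, hlt⟩
    have hm : (List.range k).findIdx (fun j => !((u j).any fun v => v != 0)) = m := by
      rcases hmk.lt_or_eq with hmk | rfl
      · rw [List.findIdx_eq (by simpa using hmk)]
        refine ⟨by simp [h0], fun j hj => ?_⟩
        rw [List.getElem_range]
        exact (key j).mpr (hlt j hj)
      · rw [List.findIdx_eq_length_of_false, List.length_range]
        intro j hj
        simpa using (key j).mpr (hlt j (List.mem_range.mp hj))
    dsimp only
    rw [hm, if_pos h0]

theorem rfind (hF : IsApprox g f F) :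
    IsApprox g (fun a => Nat.rfind fun n => (fun m => m = 0) <$> f (Nat.pair a n))
      (fun a σ => boundedFind (fun n => F (Nat.pair a n) σ) σ.length) where
  primrec := by
    have hv : Primrec₂ fun (q : ℕ × List ℕ) (j : ℕ) => F (Nat.pair q.1 j) q.2 :=
      hF.primrec.comp (Primrec₂.natPair.comp (Primrec.fst.comp Primrec.fst) Primrec.snd)
        (Primrec.snd.comp Primrec.fst)
    have hi : Primrec fun q : ℕ × List ℕ => (List.range q.2.length).findIdx fun j =>
        !((F (Nat.pair q.1 j) q.2).any fun v => v != 0) := by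
      refine Primrec.list_findIdx (Primrec.list_range.comp (Primrec.list_length.comp Primrec.snd))
        (Primrec.not.comp ?_)
      refine (Primrec.option_casesOn (σ := Bool) hv (Primrec.const false)
        (g := fun _ v => v != 0) ?_).of_eq fun q => ?_
      · exact (Primrec.not.comp (Primrec.eq.comp Primrec.snd (Primrec.const 0)).decide).of_eq
          fun q => by by_cases h : q.2 = 0 <;> simp [h]
      · dsimp only
        cases F (Nat.pair q.1.1 q.2) q.1.2 <;> rfl
    exact Primrec.ite (Primrec.eq.comp (hv.comp Primrec.id hi) (Primrec.const (some 0)))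
      (Primrec.option_some.comp hi) (Primrec.const none)
  mono {a σ τ y} hp hy := by
    rw [boundedFind_eq_some] at hy ⊢
    obtain ⟨h1, h2, h3⟩ := hy
    refine ⟨h1.trans hp.length_le, hF.mono hp h2, fun j hj => ?_⟩
    obtain ⟨v, hv, hv0⟩ := h3 j hj
    exact ⟨v, hF.mono hp hv, hv0⟩
  mem_iff a y := by
    refine Nat.mem_rfind.trans ?_
    simp only [boundedFind_eq_some, length_initSeg, Part.map_eq_map, Part.mem_map_iff, hF.mem_iff]
    constructor
    · rintro ⟨⟨v, ⟨k, hk⟩, hv⟩, h2⟩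
      have hv : v = 0 := by simpa using hv
      subst hv
      have h3 : ∀ j, ∃ l, j < y → ∃ v, F (Nat.pair a j) (initSeg g l) = some v ∧ v ≠ 0 := by
        intro j
        by_cases hj : j < y
        · obtain ⟨v, ⟨l, hl⟩, hv⟩ := h2 hj
          exact ⟨l, fun _ => ⟨v, hl, by simpa using hv⟩⟩
        · exact ⟨0, fun h => absurd h hj⟩
      choose l hl using h3
      -- This length reaches `y`, confirms the zero there, and suffices to evaluate every earlier
      -- argument.
      refine ⟨y + k + (Finset.range y).sup l, by omega, hF.mono_initSeg (by omega) hk,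
        fun j hj => ?_⟩
      obtain ⟨v, hv, hv0⟩ := hl j hj
      have := Finset.le_sup (f := l) (Finset.mem_range.mpr hj)
      exact ⟨v, hF.mono_initSeg (by omega) hv, hv0⟩
    · rintro ⟨k, _, h0, hlt⟩
      refine ⟨⟨0, ⟨k, h0⟩, by simp⟩, fun {j} hj => ?_⟩
      obtain ⟨v, hv, hv0⟩ := hlt j hj
      exact ⟨v, ⟨k, hv⟩, by simpa using hv0⟩

end IsApprox

/-- A halting computation consults only finitely many oracle values, so each constructor of relative
recursiveness preserves approximability. -/
theorem exists_isApprox_of_recursiveIn {g : ℕ → ℕ} {f : ℕ →. ℕ}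
    (hf : Nat.RecursiveIn {fun n => Part.some (g n)} f) : ∃ F, IsApprox g f F := by
  induction hf with
  | zero => exact ⟨_, IsApprox.of_primrec (Primrec.const 0)⟩
  | succ => exact ⟨_, IsApprox.of_primrec Primrec.succ⟩
  | left => exact ⟨_, IsApprox.of_primrec (Primrec.fst.comp Primrec.unpair)⟩
  | right => exact ⟨_, IsApprox.of_primrec (Primrec.snd.comp Primrec.unpair)⟩
  | oracle u hu =>
    rw [Set.mem_singleton_iff.mp hu]
    exact ⟨_, IsApprox.oracle⟩
  | pair _ _ ih₁ ih₂ =>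
    obtain ⟨F, hF⟩ := ih₁
    obtain ⟨H, hH⟩ := ih₂
    exact ⟨_, hF.pair hH⟩
  | comp _ _ ih₁ ih₂ =>
    obtain ⟨F, hF⟩ := ih₁
    obtain ⟨H, hH⟩ := ih₂
    exact ⟨_, hF.comp hH⟩
  | prec _ _ ih₁ ih₂ =>
    obtain ⟨F, hF⟩ := ih₁
    obtain ⟨H, hH⟩ := ih₂
    exact ⟨_, hF.prec hH⟩
  | rfind _ ih =>
    obtain ⟨F, hF⟩ := ih
    exact ⟨_, hF.rfind⟩

/-! ### Normal form of relative enumerability -/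

theorem recursiveIn_initSeg (g : ℕ → ℕ) :
    Nat.RecursiveIn {fun n => Part.some (g n)}
      (fun k => Part.some (Encodable.encode (initSeg g k))) := by
  let u : ℕ → ℕ := fun p =>
    Encodable.encode (((Encodable.decode (α := List ℕ) p.unpair.1).getD []) ++ [p.unpair.2])
  have hu : Primrec u := by
    refine Primrec.encode.comp (Primrec.list_concat.comp (Primrec.option_getD.comp
      (Primrec.decode.comp (Primrec.fst.comp Primrec.unpair)) (Primrec.const []))
      (Primrec.snd.comp Primrec.unpair))
  have hu' : Nat.RecursiveIn {fun n => Part.some (g n)} (fun n => Part.some (u n)) :=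
    (Primrec.nat_iff.mp hu).recursiveIn
  have hy : Nat.RecursiveIn {fun n => Part.some (g n)} fun p => Part.some p.unpair.2.unpair.1 :=
    (Primrec.nat_iff.mp (Primrec.fst.comp (Primrec.unpair.comp
      (Primrec.snd.comp Primrec.unpair)))).recursiveIn
  have hi : Nat.RecursiveIn {fun n => Part.some (g n)} fun p => Part.some p.unpair.2.unpair.2 :=
    (Primrec.nat_iff.mp (Primrec.snd.comp (Primrec.unpair.comp
      (Primrec.snd.comp Primrec.unpair)))).recursiveIn
  have h0 : Nat.RecursiveIn {fun n => Part.some (g n)}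
      fun _ => Part.some (Encodable.encode ([] : List ℕ)) :=
    (Primrec.nat_iff.mp (Primrec.const _)).recursiveIn
  -- The recursion scheme expects a parameter; `0` is a dummy.
  have hk : Nat.RecursiveIn {fun n => Part.some (g n)} fun k => Part.some (Nat.pair 0 k) :=
    (Primrec.nat_iff.mp (Primrec₂.natPair.comp (Primrec.const 0) Primrec.id)).recursiveIn
  have := Nat.RecursiveIn.comp (Nat.RecursiveIn.prec h0
    (Nat.RecursiveIn.comp hu' (Nat.RecursiveIn.pair hi
      (Nat.RecursiveIn.comp (Nat.RecursiveIn.oracle _ rfl) hy)))) hk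
  refine this.of_eq fun k => ?_
  simp only [Part.bind_eq_bind, Part.bind_some, Nat.unpair_pair]
  induction k with
  | zero => rfl
  | succ k ih =>
    rw [initSeg_succ]
    dsimp only at ih ⊢
    rw [ih]
    simp only [Part.bind_some, Nat.unpair_pair, seq_eq_bind_map, Part.map_eq_map,
      Part.map_some, Part.bind_eq_bind, u, Encodable.encodek, Option.getD_some]

section Closure

variable {α β : Type} [Primcodable α] [Primcodable β] {O : Set ℕ}

/-- The characteristic function of a set of natural numbers. -/
noncomputable def charFun (O : Set ℕ) : ℕ → ℕ := O.indicator fun _ => 1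

/-- The oracle enters only through its finite segments. Monotonicity of `R` lets several witnesses
share one segment. -/
theorem REPredIn.exists_primrecRel {p : α → Prop} (hp : REPredIn O p) :
    ∃ R : α → List ℕ → Prop, PrimrecRel R ∧ (∀ {a σ τ}, σ <+: τ → R a σ → R a τ) ∧
      ∀ a, p a ↔ ∃ k, R a (initSeg (charFun O) k) := by
  obtain ⟨F, hF⟩ := exists_isApprox_of_recursiveIn (g := charFun O) hp
  refine ⟨fun a σ => (F (Encodable.encode a) σ).isSome = true, ?_, ?_, fun a => ?_⟩
  · exact Primrec.eq.comp (Primrec.option_isSome.comp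
      (hF.primrec.comp (Primrec.encode.comp Primrec.fst) Primrec.snd)) (Primrec.const true)
  · intro a σ τ hst h
    obtain ⟨y, hy⟩ := Option.isSome_iff_exists.mp h
    exact Option.isSome_iff_exists.mpr ⟨y, hF.mono hst hy⟩
  · have h1 := hF.mem_iff (Encodable.encode a)
    simp only [Encodable.encodek, Part.coe_some, Part.bind_some, Part.mem_map_iff,
      Part.mem_assert_iff] at h1
    constructor
    · intro h
      obtain ⟨k, hk⟩ := (h1 (Encodable.encode ())).mp ⟨(), ⟨h, by simp⟩, rfl⟩
      exact ⟨k, Option.isSome_iff_exists.mpr ⟨_, hk⟩⟩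
    · rintro ⟨k, hk⟩
      obtain ⟨y, hy⟩ := Option.isSome_iff_exists.mp hk
      obtain ⟨_, ⟨h, _⟩, _⟩ := (h1 y).mpr ⟨k, hy⟩
      exact h

theorem REPredIn.of_primrecRel {R : α → List ℕ → Prop} (hR : PrimrecRel R) {p : α → Prop}
    (hp : ∀ a, p a ↔ ∃ k, R a (initSeg (charFun O) k)) : REPredIn O p := by
  classical
  let G : Set (ℕ →. ℕ) := {fun n => Part.some (charFun O n)}
  -- The default `1` makes the search for a zero diverge on numbers that code nothing.
  let t : ℕ → ℕ := fun n => ((Encodable.decode (α := α × List ℕ) n).map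
    fun q => if R q.1 q.2 then 0 else 1).getD 1
  have ht : Primrec t := by
    refine Primrec.option_getD.comp (Primrec.option_map Primrec.decode ?_) (Primrec.const 1)
    exact (Primrec.ite (PrimrecPred.comp hR Primrec.snd) (Primrec.const 0) (Primrec.const 1))
  let u : ℕ → ℕ := fun n => t (Nat.pair n.unpair.1 (Encodable.encode
    (initSeg (charFun O) n.unpair.2)))
  have h1 : Nat.RecursiveIn G fun n => Part.some n.unpair.1 := Nat.RecursiveIn.left
  have h2 : Nat.RecursiveIn G fun n => Part.some n.unpair.2 := Nat.RecursiveIn.right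
  have h3 : Nat.RecursiveIn G fun n => Part.some (u n) :=
    (Nat.RecursiveIn.comp ((Primrec.nat_iff.mp ht).recursiveIn)
      (Nat.RecursiveIn.pair h1 (Nat.RecursiveIn.comp (recursiveIn_initSeg (charFun O)) h2))).of_eq
      fun n => by simp [u, seq_eq_bind_map]
  have h4 : Nat.RecursiveIn G fun _ => Part.some (Encodable.encode ()) :=
    (Primrec.nat_iff.mp (Primrec.const _)).recursiveIn
  have hu : ∀ n k, u (Nat.pair n k) = 0 ↔
      ∃ a, Encodable.decode (α := α) n = some a ∧ R a (initSeg (charFun O) k) := by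
    intro n k
    cases hd : Encodable.decode (α := α) n with
    | none => simp [u, t, hd]
    | some a => by_cases hR : R a (initSeg (charFun O) k) <;> simp [u, t, hd, hR]
  refine (Nat.RecursiveIn.comp h4 (Nat.RecursiveIn.rfind h3)).of_eq fun n => Part.ext fun y => ?_
  refine Part.mem_bind_iff.trans ?_
  have hdom : (∃ m, m ∈ Nat.rfind fun k => (fun m => decide (m = 0)) <$>
      (Part.some (u (Nat.pair n k)) : Part ℕ)) ↔ ∃ k, u (Nat.pair n k) = 0 := by
    rw [← Part.dom_iff_mem]
    refine Nat.rfind_dom.trans ?_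
    simp
  simp only [Part.mem_some_iff, exists_and_right]
  rw [hdom]
  simp only [hu]
  cases hd : Encodable.decode (α := α) n with
  | none => simp
  | some a =>
    have hy : (∃ x : Unit, Encodable.encode x = y) ↔ y = 0 :=
      ⟨fun ⟨_, h⟩ => h.symm, fun h => ⟨(), h.symm⟩⟩
    simp [hp a, and_comm, hy]

/-! ### Closure properties of relative computable enumerability -/

theorem REPredIn.of_eq {p q : α → Prop} (hp : REPredIn O p) (h : ∀ a, p a ↔ q a) :
    REPredIn O q :=
  (funext fun a => propext (h a) : p = q) ▸ hp

theorem REPred.rePredIn {p : α → Prop} (hp : REPred p) : REPredIn O p := Partrec.recursiveIn hp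

/-- The characteristic function of the empty oracle is constantly `0`, so it can be eliminated;
closure properties then transfer to the unrelativized notion. -/
theorem REPredIn.rePred {p : α → Prop} (hp : REPredIn ∅ p) : REPred p :=
  RecursiveIn.partrec_of_const (s := Part.some 0) (by simpa [REPredIn] using hp)

theorem PrimrecPred.rePredIn {p : α → Prop} (hp : PrimrecPred p) : REPredIn O p :=
  .of_primrecRel (R := fun a _ => p a) (hp.comp Primrec.fst) (by simp)

theorem REPredIn.comp {p : β → Prop} {f : α → β} (hp : REPredIn O p) (hf : Primrec f) :
    REPredIn O fun a => p (f a) := by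
  obtain ⟨R, hR, -, h⟩ := hp.exists_primrecRel
  exact .of_primrecRel (R := fun a σ => R (f a) σ)
    (PrimrecRel.comp hR (hf.comp Primrec.fst) Primrec.snd) fun a => h _

theorem REPredIn.and {p q : α → Prop} (hp : REPredIn O p) (hq : REPredIn O q) :
    REPredIn O fun a => p a ∧ q a := by
  obtain ⟨R, hR, mR, h⟩ := hp.exists_primrecRel
  obtain ⟨S, hS, mS, h'⟩ := hq.exists_primrecRel
  refine .of_primrecRel (R := fun a σ => R a σ ∧ S a σ) (PrimrecPred.and hR hS) fun a => ?_
  rw [h, h']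
  constructor
  · rintro ⟨⟨k, hk⟩, m, hm⟩
    exact ⟨max k m, mR (initSeg_prefix _ (le_max_left _ _)) hk,
      mS (initSeg_prefix _ (le_max_right _ _)) hm⟩
  · rintro ⟨k, hk, hm⟩
    exact ⟨⟨k, hk⟩, k, hm⟩

/-- The length of the segment also bounds the code of the witness, which leaves a primitive
recursive bounded quantifier. -/
theorem REPredIn.exists {p : α → β → Prop} (hp : REPredIn O fun q : α × β => p q.1 q.2) :
    REPredIn O fun a => ∃ b, p a b := by
  obtain ⟨R, hR, mR, h⟩ := hp.exists_primrecRel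
  let L : List ℕ → List β := fun σ => (List.range σ.length).filterMap Encodable.decode
  have hL : Primrec L := Primrec.listFilterMap (Primrec.list_range.comp Primrec.list_length)
    (Primrec.decode.comp Primrec.snd)
  have hRL : PrimrecRel fun (l : List β) (q : α × List ℕ) => ∃ b ∈ l, R (q.1, b) q.2 := by
    refine PrimrecRel.exists_mem_list (R := fun (b : β) (q : α × List ℕ) => R (q.1, b) q.2) ?_
    exact PrimrecRel.comp hR ((Primrec.fst.comp Primrec.snd).pair Primrec.fst)
      (Primrec.snd.comp Primrec.snd)
  refine .of_primrecRel (R := fun a σ => ∃ b ∈ L σ, R (a, b) σ)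
    (PrimrecRel.comp hRL (hL.comp Primrec.snd) Primrec.id) fun a => ?_
  constructor
  · rintro ⟨b, hb⟩
    obtain ⟨k, hk⟩ := (h (a, b)).mp hb
    refine ⟨k + Encodable.encode b + 1, b, ?_, mR (initSeg_prefix _ (by omega)) hk⟩
    simp only [L, length_initSeg, List.mem_filterMap, List.mem_range]
    exact ⟨Encodable.encode b, by omega, Encodable.encodek b⟩
  · rintro ⟨k, b, -, hk⟩
    exact ⟨b, (h (a, b)).mpr ⟨k, hk⟩⟩

theorem REPred.exists {p : α → β → Prop} (hp : REPred fun q : α × β => p q.1 q.2) :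
    REPred fun a => ∃ b, p a b :=
  (REPredIn.exists hp.rePredIn).rePred

theorem rePredIn_mem_oracle (O : Set ℕ) : REPredIn O fun n => n ∈ O := by
  refine .of_primrecRel (R := fun n σ => σ.getD n 0 = 1) (PrimrecRel.comp Primrec.eq
    ((Primrec.list_getD 0).comp Primrec.snd Primrec.fst) (Primrec.const 1)) fun n => ?_
  constructor
  · intro hn
    refine ⟨n + 1, ?_⟩
    rw [List.getD, initSeg_getElem? _ (Nat.lt_succ_self n)]
    simp [charFun, hn]
  · rintro ⟨k, hk⟩
    rcases lt_or_ge n k with h | h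
    · by_contra hn
      rw [List.getD, initSeg_getElem? _ h] at hk
      simp [charFun, hn] at hk
    · simp [List.getD, initSeg, h] at hk

end Closure

/-! ### Selman's theorem: relative enumerability in all oracles is enumeration reducibility -/

section Selman

variable {α β : Type} [Primcodable α] [Primcodable β]

/-- The finite `0`-`1`-sequence `σ` takes the value `1` only at numbers `⟨m, a⟩` with `S a`. -/
def IsCondition (S : α → Prop) (σ : List ℕ) : Prop :=
  ∀ n < σ.length, σ.getD n 0 = 0 ∨ σ.getD n 0 = 1 ∧ ∃ a, S a ∧ Encodable.encode a = n.unpair.2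

/-- Forcing conditions, ordered by extension. -/
structure Condition (S : α → Prop) where
  /-- The finite sequence. -/
  seq : List ℕ
  isCondition : IsCondition S seq

instance (S : α → Prop) : Preorder (Condition S) where
  le σ τ := σ.seq <+: τ.seq
  le_refl _ := List.prefix_rfl
  le_trans _ _ _ := List.IsPrefix.trans

theorem IsCondition.concat {S : α → Prop} {σ : List ℕ} (hσ : IsCondition S σ) {v : ℕ}
    (hv : v = 0 ∨ v = 1 ∧ ∃ a, S a ∧ Encodable.encode a = σ.length.unpair.2) :
    IsCondition S (σ ++ [v]) := by
  intro n hn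
  rw [List.length_append, List.length_singleton] at hn
  rcases Nat.lt_succ_iff_lt_or_eq.mp hn with h | rfl
  · rw [List.getD_append _ _ _ _ h]
    exact hσ n h
  · rw [List.getD_append_right _ _ _ _ le_rfl, Nat.sub_self]
    exact hv

theorem Condition.exists_length_eq {S : α → Prop} (σ : Condition S) {n : ℕ} (hn : σ.seq.length ≤ n) :
    ∃ τ, σ ≤ τ ∧ τ.seq.length = n := by
  induction n, hn using Nat.le_induction with
  | base => exact ⟨σ, le_rfl, rfl⟩
  | succ n _ ih =>
    obtain ⟨τ, hστ, rfl⟩ := ih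
    exact ⟨⟨τ.seq ++ [0], τ.isCondition.concat (.inl rfl)⟩,
      hστ.trans (List.prefix_append _ _ : τ.seq <+: τ.seq ++ [0]), by simp⟩

/-- The conditions of length at least `n`. -/
def lengthCofinal (S : α → Prop) (n : ℕ) : Order.Cofinal (Condition S) where
  carrier := {σ | n ≤ σ.seq.length}
  isCofinal σ := by
    obtain ⟨τ, hστ, h⟩ := σ.exists_length_eq (le_max_left σ.seq.length n)
    exact ⟨τ, by simp [h], hστ⟩

/-- The conditions that enumerate `a`, if `S a`. -/
def hitCofinal (S : α → Prop) (a : α) : Order.Cofinal (Condition S) where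
  carrier := {σ | S a → ∃ m, σ.seq[Nat.pair m (Encodable.encode a)]? = some 1}
  isCofinal σ := by
    by_cases ha : S a
    -- With `m` the length of `σ`, the position `⟨m, a⟩` lies beyond `σ`, so its value is still
    -- free.
    · obtain ⟨τ, hστ, h⟩ := σ.exists_length_eq (Nat.left_le_pair σ.seq.length (Encodable.encode a))
      refine ⟨⟨τ.seq ++ [1], τ.isCondition.concat (.inr ⟨rfl, a, ha, by simp [h]⟩)⟩, fun _ => ⟨σ.seq.length, ?_⟩,
        hστ.trans (List.prefix_append _ _ : τ.seq <+: τ.seq ++ [1])⟩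
      simp [← h]
    · exact ⟨σ, fun h => absurd h ha, le_rfl⟩

/-- The conditions that decide whether the c.e. operator `R` enumerates an element outside `T`. -/
def decideCofinal (S : α → Prop) (T : β → Prop) (R : β → List ℕ → Prop) :
    Order.Cofinal (Condition S) where
  carrier := {σ | (∃ b, ¬ T b ∧ R b σ.seq) ∨ ∀ τ, σ ≤ τ → ∀ b, R b τ.seq → T b}
  isCofinal σ := by
    by_cases h : ∃ τ, σ ≤ τ ∧ ∃ b, ¬ T b ∧ R b τ.seq
    · obtain ⟨τ, hστ, b, hb⟩ := h
      exact ⟨τ, .inl ⟨b, hb⟩, hστ⟩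
    · refine ⟨σ, .inr fun τ hτ b hb => ?_, le_rfl⟩
      by_contra hT
      exact h ⟨τ, hτ, b, hT, hb⟩

theorem primrecRel_isCondition :
    PrimrecRel fun (F : List α) (σ : List ℕ) => IsCondition (· ∈ F) σ := by
  have h1 : PrimrecRel fun (F : List α) (m : ℕ) => ∃ a ∈ F, Encodable.encode a = m :=
    PrimrecRel.exists_mem_list (R := fun a m => Encodable.encode a = m)
      (PrimrecRel.comp Primrec.eq (Primrec.encode.comp Primrec.fst) Primrec.snd)
  have hget : Primrec fun q : ℕ × List α × List ℕ => q.2.2.getD q.1 0 :=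
    (Primrec.list_getD 0).comp (Primrec.snd.comp Primrec.snd) Primrec.fst
  have h2 : PrimrecRel fun (n : ℕ) (q : List α × List ℕ) => q.2.getD n 0 = 0 ∨ q.2.getD n 0 = 1 ∧
      ∃ a, a ∈ q.1 ∧ Encodable.encode a = n.unpair.2 :=
    PrimrecPred.or (PrimrecRel.comp Primrec.eq hget (Primrec.const 0))
      (PrimrecPred.and (PrimrecRel.comp Primrec.eq hget (Primrec.const 1))
        (PrimrecRel.comp h1 (Primrec.fst.comp Primrec.snd)
          (Primrec.snd.comp (Primrec.unpair.comp Primrec.fst))))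
  exact PrimrecPred.of_eq (PrimrecRel.comp h2.forall_mem_list
    (Primrec.list_range.comp (Primrec.list_length.comp Primrec.snd)) Primrec.id) fun q => by
      simp [IsCondition]

theorem rePred_prefix_isCondition {R : β → List ℕ → Prop} (hR : PrimrecRel R) (σ : List ℕ) :
    REPred fun q : β × List α => ∃ τ, σ <+: τ ∧ R q.1 τ ∧ IsCondition (· ∈ q.2) τ := by
  have h1 : PrimrecPred fun q : (β × List α) × List ℕ => σ <+: q.2 :=
    (PrimrecRel.comp Primrec.eq (Primrec.const σ)
      (Primrec.list_take.comp (Primrec.const σ.length) Primrec.snd)).of_eq fun q =>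
        List.prefix_iff_eq_take.symm
  have h2 : PrimrecPred fun q : (β × List α) × List ℕ =>
      σ <+: q.2 ∧ R q.1.1 q.2 ∧ IsCondition (· ∈ q.1.2) q.2 :=
    h1.and ((PrimrecRel.comp hR (Primrec.fst.comp Primrec.fst) Primrec.snd).and
      (PrimrecRel.comp (R := fun (F : List α) (τ : List ℕ) => IsCondition (· ∈ F) τ)
        primrecRel_isCondition (Primrec.snd.comp Primrec.fst) Primrec.snd))
  exact REPred.exists (REPredIn.rePred h2.rePredIn)

/-- A finite sequence depends on finitely many elements of `S`; these form the list `F` in Selman's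
theorem. -/
theorem IsCondition.exists_list {S : α → Prop} {σ : List ℕ} (hσ : IsCondition S σ) :
    ∃ F : List α, (∀ a ∈ F, S a) ∧ IsCondition (· ∈ F) σ := by
  classical
  refine ⟨((List.range σ.length).filterMap fun n =>
    Encodable.decode n.unpair.2).filter fun a => S a, fun a ha => ?_, fun n hn => ?_⟩
  · simpa using (List.mem_filter.mp ha).2
  · refine (hσ n hn).imp_right fun ⟨h1, a, ha, h2⟩ => ⟨h1, a, ?_, h2⟩
    simp only [List.mem_filter, List.mem_filterMap, List.mem_range, ha, decide_true, and_true]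
    exact ⟨n, hn, by rw [← h2, Encodable.encodek]⟩

theorem IsCondition.mono {S S' : α → Prop} (h : ∀ a, S a → S' a) {σ : List ℕ}
    (hσ : IsCondition S σ) : IsCondition S' σ := fun n hn =>
  (hσ n hn).imp_right fun ⟨h1, a, ha, h2⟩ => ⟨h1, a, h a ha, h2⟩

/-- Codes are countably many, so a generic ideal can decide all such relations before the relevant
one is known. -/
theorem PrimrecRel.exists_code {R : β → List ℕ → Prop} (hR : PrimrecRel R) :
    ∃ c : Nat.Partrec.Code, ∀ b σ, R b σ ↔ (c.eval (Encodable.encode (b, σ))).Dom := by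
  have h : REPred fun q : β × List ℕ => R q.1 q.2 :=
    REPredIn.rePred (PrimrecPred.rePredIn hR)
  obtain ⟨c, hc⟩ := Nat.Partrec.Code.exists_code.mp h
  refine ⟨c, fun b σ => ?_⟩
  rw [hc]
  simp [Part.assert]

/-- A generic oracle `O` built from conditions enumerates `S`, hence `T`, by some `R`. A condition
in the generic ideal decides whether `R` can err; since `R` is correct on `O`, no extension of that
condition errs. Thus `T` consists of what `R` enumerates from the extensions, and being an extension
is a positive finitary statement about `S`. -/
theorem exists_rePred_of_forall_oracle {S : α → Prop} {T : β → Prop}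
    (h : ∀ O, REPredIn O S → REPredIn O T) :
    ∃ W : β → List α → Prop, REPred (fun q : β × List α => W q.1 q.2) ∧
      ∀ b, T b ↔ ∃ F : List α, (∀ a ∈ F, S a) ∧ W b F := by
  let D : ℕ ⊕ α ⊕ Nat.Partrec.Code → Order.Cofinal (Condition S) := Sum.elim (lengthCofinal S)
    (Sum.elim (hitCofinal S) fun c =>
      decideCofinal S T fun b σ => (c.eval (Encodable.encode (b, σ))).Dom)
  let G := Order.idealOfCofinals (⟨[], fun n hn => absurd hn (by simp)⟩ : Condition S) D
  have hG : ∀ i, ∃ σ, σ ∈ D i ∧ σ ∈ G := Order.cofinal_meets_idealOfCofinals _ D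
  have hdir : ∀ σ ∈ G, ∀ τ ∈ G, ∃ ρ ∈ G, σ.seq <+: ρ.seq ∧ τ.seq <+: ρ.seq := fun σ hσ τ hτ => by
    obtain ⟨ρ, hρ, h1, h2⟩ := G.directed σ hσ τ hτ
    exact ⟨ρ, hρ, h1, h2⟩
  let O : Set ℕ := {n | ∃ σ ∈ G, σ.seq[n]? = some 1}
  -- Members of the directed `G` cannot disagree on a value, having a common extension.
  have hO : ∀ σ ∈ G, σ.seq = initSeg (charFun O) σ.seq.length := by
    intro σ hσ
    refine List.ext_getElem (by simp) fun n hn _ => ?_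
    simp only [initSeg, List.getElem_map, List.getElem_range]
    have hv := σ.isCondition n hn
    rw [List.getD_eq_getElem _ _ hn] at hv
    rcases hv with hv | ⟨hv, -⟩
    · have : n ∉ O := by
        rintro ⟨τ, hτ, h1⟩
        obtain ⟨ρ, -, ⟨s, hs⟩, t, ht⟩ := hdir σ hσ τ hτ
        obtain ⟨hn', h1⟩ := List.getElem?_eq_some_iff.mp h1
        have e1 : ρ.seq[n]? = some 0 := by
          rw [← hs, List.getElem?_append_left hn]
          exact List.getElem?_eq_some_iff.mpr ⟨hn, hv⟩
        have e2 : ρ.seq[n]? = some 1 := by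
          rw [← ht, List.getElem?_append_left hn']
          exact List.getElem?_eq_some_iff.mpr ⟨hn', h1⟩
        rw [e1] at e2
        simp at e2
      simp [charFun, this, hv]
    · have : n ∈ O := ⟨σ, hσ, by simp [hn, hv]⟩
      simp [charFun, this, hv]
  have hOS : ∀ n ∈ O, ∃ a, S a ∧ Encodable.encode a = n.unpair.2 := by
    rintro n ⟨σ, -, h1⟩
    obtain ⟨hn, h1⟩ := List.getElem?_eq_some_iff.mp h1
    have hv := σ.isCondition n hn
    rw [List.getD_eq_getElem _ _ hn, h1] at hv
    simpa using hv
  have hS : REPredIn O S := by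
    refine REPredIn.of_eq (p := fun a => ∃ m, Nat.pair m (Encodable.encode a) ∈ O)
      (REPredIn.exists ((rePredIn_mem_oracle O).comp
        (Primrec₂.natPair.comp Primrec.snd (Primrec.encode.comp Primrec.fst)))) fun a => ?_
    constructor
    · rintro ⟨m, hm⟩
      obtain ⟨b, hb, e⟩ := hOS _ hm
      rw [Nat.unpair_pair] at e
      rwa [← Encodable.encode_injective e]
    · intro ha
      obtain ⟨σ, h1, h2⟩ := hG (.inr (.inl a))
      obtain ⟨m, hm⟩ := h1 ha
      exact ⟨m, σ, h2, hm⟩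
  obtain ⟨R, hR, mR, hT⟩ := (h O hS).exists_primrecRel
  obtain ⟨c, hc⟩ := hR.exists_code
  obtain ⟨σ, h1, hσ⟩ := hG (.inr (.inr c))
  replace h1 : (∃ b, ¬ T b ∧ R b σ.seq) ∨ ∀ τ, σ ≤ τ → ∀ b, R b τ.seq → T b := by
    simp only [hc]
    exact h1
  -- The other alternative would make `R` err on a true segment of `O`.
  have h1' : ∀ τ, σ ≤ τ → ∀ b, R b τ.seq → T b := by
    refine h1.resolve_left ?_
    rintro ⟨b, hb, hRb⟩
    rw [hO σ hσ] at hRb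
    exact hb ((hT b).mpr ⟨_, hRb⟩)
  refine ⟨fun b F => ∃ τ, σ.seq <+: τ ∧ R b τ ∧ IsCondition (· ∈ F) τ,
    rePred_prefix_isCondition hR σ.seq, fun b => ?_⟩
  constructor
  · intro hb
    obtain ⟨k, hk⟩ := (hT b).mp hb
    obtain ⟨τ, hτk, hτ⟩ := hG (.inl k)
    obtain ⟨ρ, hρ, hσρ, hτρ⟩ := hdir σ hσ τ hτ
    obtain ⟨F, hF, hFρ⟩ := ρ.isCondition.exists_list
    refine ⟨F, hF, ρ.seq, hσρ, ?_, hFρ⟩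
    rw [hO ρ hρ]
    exact mR (initSeg_prefix _ (le_trans hτk hτρ.length_le)) hk
  · rintro ⟨F, hF, τ, hστ, hRb, hτ⟩
    exact h1' ⟨τ, hτ.mono hF⟩ hστ b hRb

end Selman

/-! ### Effective geometry of rational balls -/

section Geometry

open Filter Topology

/-- The radius of a rational ball. -/
noncomputable def ballRadius (b : BallIndex) : ℝ := ((b.2.1 : ℝ) + 1) / ((b.2.2 : ℝ) + 1)

theorem mem_ratBall {b : BallIndex} {x : HilbertCube} :
    x ∈ ratBall b ↔ distQ (ratPoint b.1) x < ballRadius b := Iff.rfl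

/-- Numerator and denominator of the distance of two rational points of the unit interval. -/
def coordFrac (p q : ℕ × ℕ) : ℕ × ℕ :=
  ((min p.1 (p.2 + 1) * (q.2 + 1) - min q.1 (q.2 + 1) * (p.2 + 1)) +
    (min q.1 (q.2 + 1) * (p.2 + 1) - min p.1 (p.2 + 1) * (q.2 + 1)), (p.2 + 1) * (q.2 + 1))

/-- Numerator and denominator of `s + t / 2`. -/
def addHalf (s t : ℕ × ℕ) : ℕ × ℕ := (2 * s.1 * t.2 + s.2 * t.1, 2 * s.2 * t.2)

/-- Numerator and denominator of the distance of two rational points of the Hilbert cube. -/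
def distFrac (k l : List (ℕ × ℕ)) : ℕ × ℕ :=
  ((List.range (k.length + l.length)).map fun i =>
    coordFrac (k.getD i (0, 0)) (l.getD i (0, 0))).foldr addHalf (0, 1)

theorem primrec_coordFrac : Primrec₂ coordFrac := by
  have a1 : Primrec fun q : (ℕ × ℕ) × (ℕ × ℕ) => q.1.1 := Primrec.fst.comp Primrec.fst
  have a2 : Primrec fun q : (ℕ × ℕ) × (ℕ × ℕ) => q.1.2 + 1 :=
    Primrec.succ.comp (Primrec.snd.comp Primrec.fst)
  have b1 : Primrec fun q : (ℕ × ℕ) × (ℕ × ℕ) => q.2.1 := Primrec.fst.comp Primrec.snd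
  have b2 : Primrec fun q : (ℕ × ℕ) × (ℕ × ℕ) => q.2.2 + 1 :=
    Primrec.succ.comp (Primrec.snd.comp Primrec.snd)
  have ha := Primrec.nat_mul.comp (Primrec.nat_min.comp a1 a2) b2
  have hb := Primrec.nat_mul.comp (Primrec.nat_min.comp b1 b2) a2
  exact (Primrec.nat_add.comp (Primrec.nat_sub.comp ha hb) (Primrec.nat_sub.comp hb ha)).pair
    (Primrec.nat_mul.comp a2 b2)

theorem primrec_addHalf : Primrec₂ addHalf := by
  have a1 : Primrec fun q : (ℕ × ℕ) × (ℕ × ℕ) => q.1.1 := Primrec.fst.comp Primrec.fst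
  have a2 : Primrec fun q : (ℕ × ℕ) × (ℕ × ℕ) => q.1.2 := Primrec.snd.comp Primrec.fst
  have b1 : Primrec fun q : (ℕ × ℕ) × (ℕ × ℕ) => q.2.1 := Primrec.fst.comp Primrec.snd
  have b2 : Primrec fun q : (ℕ × ℕ) × (ℕ × ℕ) => q.2.2 := Primrec.snd.comp Primrec.snd
  exact (Primrec.nat_add.comp
      (Primrec.nat_mul.comp (Primrec.nat_mul.comp (Primrec.const 2) a1) b2)
      (Primrec.nat_mul.comp a2 b1)).pair
    (Primrec.nat_mul.comp (Primrec.nat_mul.comp (Primrec.const 2) a2) b2)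

theorem primrec_distFrac : Primrec₂ distFrac := by
  refine Primrec.list_foldr (h := fun _ s => addHalf s.1 s.2) (Primrec.list_map
    (Primrec.list_range.comp (Primrec.nat_add.comp (Primrec.list_length.comp Primrec.fst)
      (Primrec.list_length.comp Primrec.snd))) ?_) (Primrec.const (0, 1)) ?_
  · exact primrec_coordFrac.comp
      ((Primrec.list_getD (0, 0)).comp (Primrec.fst.comp Primrec.fst) Primrec.snd)
      ((Primrec.list_getD (0, 0)).comp (Primrec.snd.comp Primrec.fst) Primrec.snd)
  · exact primrec_addHalf.comp (Primrec.fst.comp Primrec.snd) (Primrec.snd.comp Primrec.snd)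

theorem coordFrac_eq (k l : List (ℕ × ℕ)) (i : ℕ) :
    ((coordFrac (k.getD i (0, 0)) (l.getD i (0, 0))).1 : ℝ) /
      (coordFrac (k.getD i (0, 0)) (l.getD i (0, 0))).2 =
      |(ratPoint k i : ℝ) - (ratPoint l i : ℝ)| := by
  have hproj : ∀ p : ℕ × ℕ, (Set.projIcc (0 : ℝ) 1 zero_le_one ((p.1 : ℝ) / (p.2 + 1)) : ℝ) =
      ((min p.1 (p.2 + 1) : ℕ) : ℝ) / ((p.2 + 1 : ℕ) : ℝ) := by
    intro p
    have h1 : (0 : ℝ) < (p.2 : ℝ) + 1 := by positivity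
    rw [Set.coe_projIcc, max_eq_right (le_min zero_le_one (by positivity))]
    push_cast
    rw [← min_div_div_right h1.le, div_self h1.ne', min_comm]
  -- One of the two truncated differences vanishes; the other is the absolute value.
  have hsub : ∀ a b : ℕ, ((a - b + (b - a) : ℕ) : ℝ) = |(a : ℝ) - b| := by
    intro a b
    rcases le_total a b with h | h
    · rw [Nat.sub_eq_zero_of_le h, zero_add, Nat.cast_sub h, abs_sub_comm, abs_of_nonneg]
      exact sub_nonneg.mpr (by exact_mod_cast h)
    · rw [Nat.sub_eq_zero_of_le h, add_zero, Nat.cast_sub h, abs_of_nonneg]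
      exact sub_nonneg.mpr (by exact_mod_cast h)
  unfold ratPoint
  rw [hproj, hproj, coordFrac, hsub, div_sub_div _ _ (by positivity) (by positivity), abs_div]
  rw [abs_of_nonneg (a := ((k.getD i (0, 0)).2 + 1 : ℕ) * (((l.getD i (0, 0)).2 + 1 : ℕ) : ℝ))
    (by positivity)]
  push_cast
  congr 2
  ring

/-- The fold is Horner's scheme at `1 / 2`, so the induction peels off the term with index `0`. -/
theorem foldr_addHalf_eq (n : ℕ) (t : ℕ → ℕ × ℕ) (ht : ∀ i, 0 < (t i).2) :
    0 < (((List.range n).map t).foldr addHalf (0, 1)).2 ∧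
    ((((List.range n).map t).foldr addHalf (0, 1)).1 : ℝ) /
      (((List.range n).map t).foldr addHalf (0, 1)).2 =
      ∑ i ∈ Finset.range n, (1 / 2 : ℝ) ^ i * ((t i).1 / (t i).2) := by
  induction n generalizing t with
  | zero => simp
  | succ n ih =>
    obtain ⟨h1, h2⟩ := ih (fun i => t (i + 1)) fun i => ht _
    have hmap : (List.range (n + 1)).map t = t 0 :: (List.range n).map fun i => t (i + 1) := by
      simp [List.range_succ_eq_map]
    rw [hmap, List.foldr_cons, Finset.sum_range_succ']
    set s := ((List.range n).map fun i => t (i + 1)).foldr addHalf (0, 1)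
    have h0 := ht 0
    refine ⟨by simp only [addHalf]; positivity, ?_⟩
    have h3 : ∑ i ∈ Finset.range n, (1 / 2 : ℝ) ^ (i + 1) * ((t (i + 1)).1 / (t (i + 1)).2) =
        1 / 2 * ((s.1 : ℝ) / s.2) := by
      rw [h2, Finset.mul_sum]
      exact Finset.sum_congr rfl fun i _ => by ring
    rw [h3]
    simp only [addHalf]
    push_cast
    field_simp
    ring

theorem distFrac_den_pos (k l : List (ℕ × ℕ)) : 0 < (distFrac k l).2 :=
  (foldr_addHalf_eq _ _ fun i => by simp [coordFrac]).1

theorem distQ_ratPoint (k l : List (ℕ × ℕ)) :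
    distQ (ratPoint k) (ratPoint l) = ((distFrac k l).1 : ℝ) / (distFrac k l).2 := by
  rw [distFrac, (foldr_addHalf_eq _ _ fun i => by simp [coordFrac]).2, distQ]
  simp only [coordFrac_eq]
  -- Beyond the sum of the two lengths both points have coordinate `0`, so the series is finite.
  refine tsum_eq_sum fun i hi => ?_
  rw [Finset.mem_range, not_lt] at hi
  have hk : k.getD i (0, 0) = (0, 0) := List.getD_eq_default _ _ (by omega)
  have hl : l.getD i (0, 0) = (0, 0) := List.getD_eq_default _ _ (by omega)
  simp only [ratPoint, hk, hl, sub_self, abs_zero, mul_zero]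

/-- Clearing the positive denominators leaves an inequality between natural numbers. -/
theorem primrecRel_radius_add_le_dist : PrimrecRel fun b c : BallIndex =>
    ballRadius b + ballRadius c ≤ distQ (ratPoint b.1) (ratPoint c.1) := by
  have hd : Primrec fun q : BallIndex × BallIndex => distFrac q.1.1 q.2.1 :=
    primrec_distFrac.comp (Primrec.fst.comp Primrec.fst) (Primrec.fst.comp Primrec.snd)
  have m : Primrec fun q : BallIndex × BallIndex => q.1.2.1 + 1 :=
    Primrec.succ.comp (Primrec.fst.comp (Primrec.snd.comp Primrec.fst))
  have n : Primrec fun q : BallIndex × BallIndex => q.1.2.2 + 1 :=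
    Primrec.succ.comp (Primrec.snd.comp (Primrec.snd.comp Primrec.fst))
  have m' : Primrec fun q : BallIndex × BallIndex => q.2.2.1 + 1 :=
    Primrec.succ.comp (Primrec.fst.comp (Primrec.snd.comp Primrec.snd))
  have n' : Primrec fun q : BallIndex × BallIndex => q.2.2.2 + 1 :=
    Primrec.succ.comp (Primrec.snd.comp (Primrec.snd.comp Primrec.snd))
  have hl := Primrec.nat_mul.comp (Primrec.nat_add.comp (Primrec.nat_mul.comp m n')
    (Primrec.nat_mul.comp n m')) (Primrec.snd.comp hd)
  have hr := Primrec.nat_mul.comp (Primrec.fst.comp hd) (Primrec.nat_mul.comp n n')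
  refine PrimrecPred.of_eq (PrimrecRel.comp Primrec.nat_le hl hr) fun q => ?_
  have hpos : (0 : ℝ) < (distFrac q.1.1 q.2.1).2 := by exact_mod_cast distFrac_den_pos _ _
  dsimp only
  rw [distQ_ratPoint, ballRadius, ballRadius, div_add_div _ _ (by positivity) (by positivity),
    div_le_div_iff₀ (by positivity) hpos]
  exact_mod_cast Iff.rfl

theorem primrecRel_dist_add_radius_le : PrimrecRel fun b c : BallIndex =>
    distQ (ratPoint b.1) (ratPoint c.1) + ballRadius b ≤ ballRadius c := by
  have hd : Primrec fun q : BallIndex × BallIndex => distFrac q.1.1 q.2.1 :=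
    primrec_distFrac.comp (Primrec.fst.comp Primrec.fst) (Primrec.fst.comp Primrec.snd)
  have m : Primrec fun q : BallIndex × BallIndex => q.1.2.1 + 1 :=
    Primrec.succ.comp (Primrec.fst.comp (Primrec.snd.comp Primrec.fst))
  have n : Primrec fun q : BallIndex × BallIndex => q.1.2.2 + 1 :=
    Primrec.succ.comp (Primrec.snd.comp (Primrec.snd.comp Primrec.fst))
  have m' : Primrec fun q : BallIndex × BallIndex => q.2.2.1 + 1 :=
    Primrec.succ.comp (Primrec.fst.comp (Primrec.snd.comp Primrec.snd))
  have n' : Primrec fun q : BallIndex × BallIndex => q.2.2.2 + 1 :=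
    Primrec.succ.comp (Primrec.snd.comp (Primrec.snd.comp Primrec.snd))
  have hl := Primrec.nat_mul.comp (Primrec.nat_add.comp (Primrec.nat_mul.comp (Primrec.fst.comp hd)
    n) (Primrec.nat_mul.comp (Primrec.snd.comp hd) m)) n'
  have hr := Primrec.nat_mul.comp m' (Primrec.nat_mul.comp (Primrec.snd.comp hd) n)
  refine PrimrecPred.of_eq (PrimrecRel.comp Primrec.nat_le hl hr) fun q => ?_
  have hpos : (0 : ℝ) < (distFrac q.1.1 q.2.1).2 := by exact_mod_cast distFrac_den_pos _ _
  dsimp only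
  rw [distQ_ratPoint, ballRadius, ballRadius, div_add_div _ _ hpos.ne' (by positivity),
    div_le_div_iff₀ (by positivity) (by positivity)]
  exact_mod_cast Iff.rfl

theorem disjoint_ratBall {b c : BallIndex}
    (h : ballRadius b + ballRadius c ≤ distQ (ratPoint b.1) (ratPoint c.1)) :
    Disjoint (ratBall b) (ratBall c) := by
  refine Set.disjoint_left.mpr fun x hb hc => ?_
  rw [mem_ratBall] at hb hc
  have := distQ_triangle (ratPoint b.1) x (ratPoint c.1)
  rw [distQ_comm x] at this
  linarith

theorem ratBall_subset {b c : BallIndex}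
    (h : distQ (ratPoint b.1) (ratPoint c.1) + ballRadius b ≤ ballRadius c) :
    ratBall b ⊆ ratBall c := by
  intro x hx
  rw [mem_ratBall] at hx ⊢
  have := distQ_triangle (ratPoint c.1) (ratPoint b.1) x
  rw [distQ_comm (ratPoint c.1) (ratPoint b.1)] at this
  linarith

/-! ### Small balls and finite covers of compact sets -/

/-- The filter of small rational balls around `x`. -/
noncomputable def smallBalls (x : HilbertCube) : Filter BallIndex :=
  comap ballRadius (𝓝 0) ⊓ 𝓟 {b | x ∈ ratBall b}

theorem eventually_smallBalls_mem (x : HilbertCube) : ∀ᶠ b in smallBalls x, x ∈ ratBall b :=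
  mem_inf_of_right (mem_principal_self _)

theorem eventually_smallBalls_radius (x : HilbertCube) {ε : ℝ} (hε : 0 < ε) :
    ∀ᶠ b in smallBalls x, ballRadius b < ε :=
  mem_inf_of_left (preimage_mem_comap (Iio_mem_nhds hε))

instance (x : HilbertCube) : (smallBalls x).NeBot := by
  refine ((nhds_basis_Ioo_pos (0 : ℝ)).comap _ |>.inf_principal _).neBot_iff.mpr fun {ε} hε => ?_
  obtain ⟨n, hn⟩ := exists_nat_one_div_lt hε
  have h0 : (0 : ℝ) < 1 / ((n : ℝ) + 1) := by positivity
  obtain ⟨l, hl⟩ := exists_ratPoint_mem (x := x) (isOpen_lt (continuous_distQ.comp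
    (by fun_prop : Continuous fun y => (y, x))) (continuous_const (y := 1 / ((n : ℝ) + 1))))
    (by simpa [distQ_self] using h0)
  have hr : ballRadius (l, 0, n) = 1 / ((n : ℝ) + 1) := by simp [ballRadius]
  refine ⟨(l, 0, n), ?_, ?_⟩
  · simp only [Set.mem_preimage, hr, Set.mem_Ioo]
    constructor <;> linarith
  · change x ∈ ratBall (l, 0, n)
    rw [mem_ratBall, hr]
    exact hl

theorem eventually_smallBalls_subset {x : HilbertCube} {c : BallIndex} (hx : x ∈ ratBall c) :
    ∀ᶠ b in smallBalls x, distQ (ratPoint b.1) (ratPoint c.1) + ballRadius b ≤ ballRadius c := by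
  rw [mem_ratBall] at hx
  filter_upwards [eventually_smallBalls_mem x, eventually_smallBalls_radius x
    (half_pos (sub_pos.mpr hx))] with b h1 h2
  rw [mem_ratBall] at h1
  have := distQ_triangle (ratPoint b.1) x (ratPoint c.1)
  rw [distQ_comm x] at this
  linarith

/-- The distance from `x` to `K` is attained and positive, so `b` can be chosen before `y`. With
both radii below a quarter of it, the centers stay more than half of it apart. -/
theorem eventually_smallBalls_disjoint {x : HilbertCube} {K : Set HilbertCube} (hK : IsCompact K)
    (hx : x ∉ K) : ∀ᶠ b in smallBalls x, ∀ y ∈ K, ∀ᶠ c in smallBalls y,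
      ballRadius b + ballRadius c ≤ distQ (ratPoint b.1) (ratPoint c.1) := by
  rcases K.eq_empty_or_nonempty with rfl | hne
  · simp
  have hc : Continuous fun y => distQ x y :=
    continuous_distQ.comp (by fun_prop : Continuous fun y => (x, y))
  obtain ⟨z, hz, hmin⟩ := hK.exists_isMinOn hne hc.continuousOn
  have hd : 0 < distQ x z := distQ_pos fun h => hx (h ▸ hz)
  filter_upwards [eventually_smallBalls_mem x, eventually_smallBalls_radius x
    (show 0 < distQ x z / 4 by linarith)] with b h1 h2 y hy
  filter_upwards [eventually_smallBalls_mem y, eventually_smallBalls_radius y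
    (show 0 < distQ x z / 4 by linarith)] with c h3 h4
  rw [mem_ratBall] at h1 h3
  have h5 : distQ x z ≤ distQ x y := hmin hy
  have h6 := distQ_triangle x (ratPoint b.1) y
  have h7 := distQ_triangle (ratPoint b.1) (ratPoint c.1) y
  rw [distQ_comm x (ratPoint b.1)] at h6
  linarith

/-- A compact set can be covered by finitely many rational balls that satisfy any property shared by
the small balls around its points. -/
theorem IsCompact.exists_list_ratBall {K : Set HilbertCube} (hK : IsCompact K)
    {p : BallIndex → Prop} (hp : ∀ x ∈ K, ∀ᶠ b in smallBalls x, p b) :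
    ∃ l : List BallIndex, (∀ b ∈ l, p b) ∧ K ⊆ ⋃ b ∈ l, ratBall b := by
  obtain ⟨t, ht⟩ := hK.elim_finite_subcover (fun b : {b // p b} => ratBall b)
    (fun b => isOpen_ratBall b) fun x hx => by
      obtain ⟨b, hb, hxb⟩ := ((hp x hx).and (eventually_smallBalls_mem x)).exists
      exact Set.mem_iUnion.mpr ⟨⟨b, hb⟩, hxb⟩
  refine ⟨t.toList.map Subtype.val, fun b hb => ?_, fun x hx => ?_⟩
  · obtain ⟨c, -, rfl⟩ := List.mem_map.mp hb
    exact c.2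
  · obtain ⟨b, hb, hxb⟩ := Set.mem_iUnion₂.mp (ht hx)
    exact Set.mem_iUnion₂.mpr ⟨b, List.mem_map.mpr ⟨b, Finset.mem_toList.mpr hb, rfl⟩, hxb⟩

end Geometry

/-! ### Strong computable type and minimality -/

theorem IsCopy.isPair {X : Type*} [TopologicalSpace X] {A : Set X}
    {p : Compacts HilbertCube × Compacts HilbertCube} (hp : IsCopy A p) : IsPair p := by
  obtain ⟨h, hA⟩ := hp
  rw [IsPair, ← hA]
  rintro _ ⟨x, -, rfl⟩
  exact (h x).2

/-- Ball `i` meets `p.1` iff adjoining `i` to both lists of some index in `E` gives covers of `p.1`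
and `p.2`. -/
theorem IsMinimalFor.overtIn {P : Set (Compacts HilbertCube × Compacts HilbertCube)}
    {p : Compacts HilbertCube × Compacts HilbertCube} (hp : IsMinimalFor P p)
    (hP : EffectivelyClosed upBasis₂ P) {O : Set ℕ}
    (h1 : SemicomputableIn O ratBall (p.1 : Set HilbertCube))
    (h2 : SemicomputableIn O ratBall (p.2 : Set HilbertCube)) :
    OvertIn O ratBall (p.1 : Set HilbertCube) := by
  obtain ⟨E, hE, hPE⟩ := hP
  obtain ⟨hpair, hpP, hmin⟩ := hp
  have hcons : ∀ (i : BallIndex) (l : List BallIndex),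
      ⋃ b ∈ i :: l, ratBall b = ratBall i ∪ ⋃ b ∈ l, ratBall b := fun i l => by
    ext x
    simp
  have hre : REPredIn O fun i : BallIndex => ∃ e : List BallIndex × List BallIndex, e ∈ E ∧
      (p.1 : Set HilbertCube) ⊆ ⋃ b ∈ i :: e.1, ratBall b ∧
      (p.2 : Set HilbertCube) ⊆ ⋃ b ∈ i :: e.2, ratBall b :=
    REPredIn.exists ((hE.rePredIn.comp Primrec.snd).and
      ((h1.2.comp (Primrec.list_cons.comp Primrec.fst (Primrec.fst.comp Primrec.snd))).and
        (h2.2.comp (Primrec.list_cons.comp Primrec.fst (Primrec.snd.comp Primrec.snd)))))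
  refine hre.of_eq fun i => ?_
  simp only [hcons]
  constructor
  · rintro ⟨e, he, hY, hB⟩
    by_contra hne
    rw [Set.not_nonempty_iff_eq_empty, ← Set.disjoint_iff_inter_eq_empty] at hne
    -- A ball disjoint from `p.1` contributes nothing to either cover, so `p` itself would lie
    -- outside `P`.
    have hmem : p ∈ Pᶜ := by
      rw [hPE]
      exact Set.mem_iUnion₂.mpr ⟨e, he, hne.subset_right_of_subset_union hY,
        (hne.mono_left hpair).subset_right_of_subset_union hB⟩
    exact hmem hpP
  · rintro ⟨x, hxY, hxi⟩
    let q : Compacts HilbertCube × Compacts HilbertCube :=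
      (⟨p.1 \ ratBall i, p.1.isCompact.diff (isOpen_ratBall i)⟩,
        ⟨p.2 \ ratBall i, p.2.isCompact.diff (isOpen_ratBall i)⟩)
    have hq : q ∈ Pᶜ := hmin q ⟨Set.sdiff_subset_sdiff_left hpair, hpair,
      ⟨Set.sdiff_subset, fun h => (h hxY).2 hxi⟩, Set.sdiff_subset⟩
    rw [hPE] at hq
    obtain ⟨e, he, hY, hB⟩ := Set.mem_iUnion₂.mp hq
    exact ⟨e, he, Set.sdiff_subset_iff.mp hY, Set.sdiff_subset_iff.mp hB⟩

/-! ### The property for which a given pair is minimal -/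

/-- For every member `(true, l)` of `F`, each ball indexed by `e.1` is formally contained in a ball
indexed by `l`; for every member `(false, l)` of `F`, the same holds for `e.2`. -/
def FormallyRefines (e : List BallIndex × List BallIndex) (F : List (Bool × List BallIndex)) :
    Prop :=
  ∀ s ∈ F, ∀ b ∈ (bif s.1 then e.1 else e.2), ∃ c ∈ s.2,
    distQ (ratPoint b.1) (ratPoint c.1) + ballRadius b ≤ ballRadius c

/-- The rational ball with index `i` is formally disjoint from the balls with indices in `l`. -/
def FormallyDisjoint (i : BallIndex) (l : List BallIndex) : Prop :=
  ∀ b ∈ l, ballRadius i + ballRadius b ≤ distQ (ratPoint i.1) (ratPoint b.1)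

theorem primrecRel_formallyRefines : PrimrecRel FormallyRefines := by
  have h1 : PrimrecRel fun (l : List BallIndex) (b : BallIndex) => ∃ c ∈ l,
      distQ (ratPoint b.1) (ratPoint c.1) + ballRadius b ≤ ballRadius c :=
    PrimrecRel.exists_mem_list (R := fun c b : BallIndex =>
      distQ (ratPoint b.1) (ratPoint c.1) + ballRadius b ≤ ballRadius c)
      primrecRel_dist_add_radius_le.swap
  have h2 : PrimrecRel fun (l l' : List BallIndex) => ∀ b ∈ l, ∃ c ∈ l',
      distQ (ratPoint b.1) (ratPoint c.1) + ballRadius b ≤ ballRadius c :=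
    PrimrecRel.forall_mem_list (R := fun (b : BallIndex) (l : List BallIndex) => ∃ c ∈ l,
      distQ (ratPoint b.1) (ratPoint c.1) + ballRadius b ≤ ballRadius c) h1.swap
  have h3 : PrimrecRel fun (s : Bool × List BallIndex) (e : List BallIndex × List BallIndex) =>
      ∀ b ∈ (bif s.1 then e.1 else e.2), ∃ c ∈ s.2,
        distQ (ratPoint b.1) (ratPoint c.1) + ballRadius b ≤ ballRadius c :=
    PrimrecRel.comp h2 (Primrec.cond (Primrec.fst.comp Primrec.fst)
      (Primrec.fst.comp Primrec.snd) (Primrec.snd.comp Primrec.snd))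
      (Primrec.snd.comp Primrec.fst)
  exact h3.forall_mem_list.swap

theorem primrecRel_formallyDisjoint : PrimrecRel FormallyDisjoint :=
  (PrimrecRel.forall_mem_list (R := fun b i : BallIndex =>
    ballRadius i + ballRadius b ≤ distQ (ratPoint i.1) (ratPoint b.1))
    primrecRel_radius_add_le_dist.swap).swap

theorem FormallyRefines.subset {e : List BallIndex × List BallIndex}
    {F : List (Bool × List BallIndex)} (h : FormallyRefines e F) {s : Bool × List BallIndex}
    (hs : s ∈ F) : ⋃ b ∈ (bif s.1 then e.1 else e.2), ratBall b ⊆ ⋃ b ∈ s.2, ratBall b := by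
  refine Set.iUnion₂_subset fun b hb => ?_
  obtain ⟨c, hc, hbc⟩ := h s hs b hb
  exact (ratBall_subset hbc).trans (Set.subset_biUnion_of_mem (u := ratBall) hc)

theorem FormallyDisjoint.disjoint {i : BallIndex} {l : List BallIndex}
    (h : FormallyDisjoint i l) : Disjoint (ratBall i) (⋃ b ∈ l, ratBall b) := by
  simp only [Set.disjoint_iUnion_right]
  exact fun b hb => disjoint_ratBall (h b hb)

theorem eventually_smallBalls_refines {x : HilbertCube} {F : List (Bool × List BallIndex)}
    {v : Bool} (hx : ∀ s ∈ F, s.1 = v → x ∈ ⋃ b ∈ s.2, ratBall b) :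
    ∀ᶠ b in smallBalls x, ∀ s ∈ F, s.1 = v → ∃ c ∈ s.2,
      distQ (ratPoint b.1) (ratPoint c.1) + ballRadius b ≤ ballRadius c := by
  refine (Filter.eventually_all_finite (List.finite_toSet F)).mpr fun s hs => ?_
  by_cases hv : s.1 = v
  · obtain ⟨c, hc, hxc⟩ := Set.mem_iUnion₂.mp (hx s hs hv)
    filter_upwards [eventually_smallBalls_subset hxc] with b hb _
    exact ⟨c, hc, hb⟩
  · exact Filter.Eventually.of_forall fun b h => absurd h hv

theorem exists_effectivelyClosed_isMinimalFor {p : Compacts HilbertCube × Compacts HilbertCube}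
    (hp : IsPair p)
    (h : ∀ O, SemicomputableIn O ratBall (p.1 : Set HilbertCube) →
      SemicomputableIn O ratBall (p.2 : Set HilbertCube) →
      OvertIn O ratBall (p.1 : Set HilbertCube)) :
    ∃ P, EffectivelyClosed upBasis₂ P ∧ IsMinimalFor P p := by
  let K : Bool → Compacts HilbertCube := fun v => bif v then p.1 else p.2
  obtain ⟨W, hW, hT⟩ := exists_rePred_of_forall_oracle
    -- The Boolean tag joins the covers of both components into one predicate, as Selman's theorem
    -- requires.
    (S := fun s : Bool × List BallIndex => (K s.1 : Set HilbertCube) ⊆ ⋃ b ∈ s.2, ratBall b)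
    (T := fun i : BallIndex => ((p.1 : Set HilbertCube) ∩ ratBall i).Nonempty)
    (fun O hO => h O
      ⟨p.1.isCompact, hO.comp (f := fun l : List BallIndex => (true, l))
        ((Primrec.const true).pair Primrec.id)⟩
      ⟨p.2.isCompact, hO.comp (f := fun l : List BallIndex => (false, l))
        ((Primrec.const false).pair Primrec.id)⟩)
  let E : Set (List BallIndex × List BallIndex) :=
    {e | ∃ iF : BallIndex × List (Bool × List BallIndex),
      W iF.1 iF.2 ∧ FormallyDisjoint iF.1 e.1 ∧ FormallyRefines e iF.2}
  have hE : REPred fun e => e ∈ E := by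
    refine REPred.exists (REPredIn.rePred ((hW.rePredIn.comp Primrec.snd).and
      (PrimrecPred.rePredIn (PrimrecPred.and
        (PrimrecRel.comp primrecRel_formallyDisjoint (Primrec.fst.comp Primrec.snd)
          (Primrec.fst.comp Primrec.fst))
        (PrimrecRel.comp primrecRel_formallyRefines Primrec.fst
          (Primrec.snd.comp Primrec.snd))))))
  refine ⟨(⋃ e ∈ E, upBasis₂ e)ᶜ, ⟨E, hE, compl_compl _⟩, hp, fun hmem => ?_, fun q hq => ?_⟩
  · obtain ⟨e, ⟨⟨i, F⟩, hWiF, hdisj, href⟩, h1, h2⟩ := Set.mem_iUnion₂.mp hmem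
    -- If `e` covered `p`, refinement would make all covers in `F` true, so ball `i` would meet
    -- `p.1`, although it is disjoint from the balls of `e.1`.
    obtain ⟨x, hxY, hxi⟩ := (hT i).mpr ⟨F, fun s hs => by
      refine Set.Subset.trans ?_ (href.subset hs)
      rcases s with ⟨_ | _, l⟩
      · exact h2
      · exact h1, hWiF⟩
    exact Set.disjoint_left.mp hdisj.disjoint hxi (h1 hxY)
  · obtain ⟨-, -, ⟨hsub, hnot⟩, hsub2⟩ := hq
    obtain ⟨x, hxY, hxq⟩ := Set.not_subset.mp hnot
    rw [Set.mem_compl_iff, not_not]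
    -- A ball around a lost point `x` meets `p.1`, which yields `F`. Only then are the covers of `q`
    -- chosen, fine enough to refine `F` and, for `q.1`, to avoid ball `i`.
    obtain ⟨i, hi, hxi⟩ := ((eventually_smallBalls_disjoint q.1.isCompact hxq).and
      (eventually_smallBalls_mem x)).exists
    obtain ⟨F, hF, hWiF⟩ := (hT i).mp ⟨x, hxY, hxi⟩
    obtain ⟨l, hl, hql⟩ := q.1.isCompact.exists_list_ratBall fun y hy =>
      (hi y hy).and (eventually_smallBalls_refines (x := y) (F := F) (v := true) fun s hs hv => by
        have := hF s hs
        rw [hv] at this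
        exact this (hsub hy))
    obtain ⟨l', hl', hql'⟩ := q.2.isCompact.exists_list_ratBall fun y hy =>
      eventually_smallBalls_refines (x := y) (F := F) (v := false) fun s hs hv => by
        have := hF s hs
        rw [hv] at this
        exact this (hsub2 hy)
    refine Set.mem_iUnion₂.mpr ⟨(l, l'), ⟨(i, F), hWiF, fun b hb => (hl b hb).1, ?_⟩, hql, hql'⟩
    rintro ⟨_ | _, m⟩ hs b hb
    · exact hl' b hb _ hs rfl
    · exact (hl b hb).2 _ hs rfl

theorem mainTheorem2 {X : Type*} [TopologicalSpace X] [CompactSpace X] [MetrizableSpace X]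
    (A : Set X) (hA : IsCompact A) :
    HasStrongComputableType A ↔
      ∀ p : Compacts HilbertCube × Compacts HilbertCube, IsCopy A p →
        ∃ P : Set (Compacts HilbertCube × Compacts HilbertCube),
          EffectivelyClosed upBasis₂ P ∧ IsMinimalFor P p := by
  constructor
  · intro h p hp
    exact exists_effectivelyClosed_isMinimalFor hp.isPair fun O h1 h2 => (h O p hp h1 h2).2
  · intro h O p hp h1 h2
    obtain ⟨P, hP, hm⟩ := h p hp
    exact ⟨h1, hm.overtIn hP h1 h2⟩
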